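/- Let $G$ be a finite abelian group of rank $r$, i.e. $r$ is the minimal number of elements needed to generate $G$. A covariant of $G$ is a $G$-equivariant morphism (polynomial map) $\varphi\colon V\to W$ between finite-dimensional complex linear representations $V,W$ of $G$; it is called faithful if $G$ acts faithfully on the image $\varphi(V)$, and its dimension is $\dim\varphi:=\dim\overline{\varphi(V)}$, the dimension of the Zariski closure of its image. The covariant dimension $\operatorname{covdim} G$ is the minimum of $\dim\varphi$ over all faithful covariants $\varphi$ of $G$. Then $$\operatorname{covdim} G = r.$$ -/

import Mathlib

universe v u

/-- The algebra `𝒪(V)` of polynomial (regular) functions on a complex vector space `V`: the algebra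
of functions on `V` generated by the linear functionals. -/
def polyFun (V : Type*) [AddCommGroup V] [Module ℂ V] : Subalgebra ℂ (V → ℂ) :=
  Algebra.adjoin ℂ (Set.range fun (l : Module.Dual ℂ V) (v : V) => l v)

/-- A map `φ : V → W` of complex vector spaces is a morphism (of varieties) if all its coordinate
functions are polynomial functions on `V`. -/
def IsPolyMorphism {V W : Type*} [AddCommGroup V] [Module ℂ V] [AddCommGroup W] [Module ℂ W]
    (φ : V → W) : Prop :=
  ∀ l : Module.Dual ℂ W, (fun v => l (φ v)) ∈ polyFun V

/-- The Zariski closure of a subset `S` of `W`: the common zeros of all polynomial functions that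
vanish on `S`. -/
def zariskiClosure {W : Type*} [AddCommGroup W] [Module ℂ W] (S : Set W) : Set W :=
  {w | ∀ f ∈ polyFun W, (∀ s ∈ S, f s = 0) → f w = 0}

/-- Restriction of functions from `W` to a subset `X`, as a homomorphism of algebras. -/
def restrictFun {W : Type*} (X : Set W) : (W → ℂ) →ₐ[ℂ] (X → ℂ) :=
  AlgHom.pi fun x : X => Pi.evalAlgHom ℂ (fun _ : W => ℂ) x.1

/-- The coordinate ring `𝒪(X)` of a Zariski closed subset `X` of `W`: the restrictions to `X` of the
polynomial functions on `W`. -/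
def coordRing {W : Type*} [AddCommGroup W] [Module ℂ W] (X : Set W) : Subalgebra ℂ (X → ℂ) :=
  (polyFun W).map (restrictFun X)

/-- The dimension of a Zariski closed subset `X` of `W`: the Krull dimension of its coordinate
ring. -/
noncomputable def varietyDim {W : Type*} [AddCommGroup W] [Module ℂ W] (X : Set W) :
    WithBot ℕ∞ :=
  ringKrullDim (coordRing X)

/-- A covariant of `G`: an equivariant morphism `φ : V → W` between `G`-modules. -/
structure IsCovariant {G V W : Type*} [Group G] [AddCommGroup V] [Module ℂ V]
    [AddCommGroup W] [Module ℂ W] (ρ : Representation ℂ G V) (σ : Representation ℂ G W)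
    (φ : V → W) : Prop where
  morphism : IsPolyMorphism φ
  equivariant : ∀ (g : G) (v : V), φ (ρ g v) = σ g (φ v)

/-- `G` acts faithfully on the image `φ(V)`. -/
def FaithfulOnImage {G V W : Type*} [Group G] [AddCommGroup W] [Module ℂ W]
    (σ : Representation ℂ G W) (φ : V → W) : Prop :=
  ∀ g : G, (∀ w ∈ Set.range φ, σ g w = w) → g = 1

/-- The dimension of a map: the dimension of the Zariski closure of its image. -/
noncomputable def mapDim {V W : Type*} [AddCommGroup W] [Module ℂ W] (φ : V → W) : WithBot ℕ∞ :=
  varietyDim (zariskiClosure (Set.range φ))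

/-- The set of the dimensions of all faithful covariants of `G` between finite dimensional complex
`G`-modules. -/
def faithfulCovariantDims (G : Type u) [Group G] : Set (WithBot ℕ∞) :=
  {d | ∃ (V W : Type v) (_ : AddCommGroup V) (_ : Module ℂ V) (_ : FiniteDimensional ℂ V)
      (_ : AddCommGroup W) (_ : Module ℂ W) (_ : FiniteDimensional ℂ W)
      (ρ : Representation ℂ G V) (σ : Representation ℂ G W) (φ : V → W),
      IsCovariant ρ σ φ ∧ FaithfulOnImage σ φ ∧ mapDim φ = d}

/-- The covariant dimension of `G`: the minimum of the dimensions of all faithful covariants of `G`.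
The order of `WithBot ℕ∞` is a well-order, so that the infimum of a nonempty set is attained; the
infimum of the empty set would be `⊤`. The universe of the modules is arbitrary, since every finite
dimensional module has an isomorphic copy in every universe. -/
noncomputable def covdim (G : Type u) [Group G] : WithBot ℕ∞ :=
  sInf (faithfulCovariantDims.{v, u} G)

/-! Upper bound: the character group has the same rank `r` as `G`, and `r` generating characters
separate points, so the identity of the diagonal representation on `ℂ^r` is a faithful covariant of
dimension at most `r`.

Lower bound: let `φ : V → W` be a faithful covariant. The weights of the semi-invariant functionals
on `W` that do not vanish on `φ(V)` separate `G`, hence generate the character group. By a Chinese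
remainder argument, `r` of these weights are independent modulo some prime `p`
(`exists_prime_exists_independent_mod`). Pulled back to `V`, the functionals become nonzero
polynomials in semi-invariant coordinates, and every monomial of such a polynomial has its weight
(`prod_weight_eq_of_mem_support`). Independence of the weights modulo `p` makes the leading
exponents linearly independent (`eq_zero_of_independent_mod`), so the polynomials are algebraically
independent. Hence the coordinate ring of the closure of the image has `r` algebraically independent
elements, and Noether normalization bounds its Krull dimension below by `r`. -/

/-! ### Generators of finite abelian groups, one prime at a time -/

/-- A finite abelian group that is divisible by every prime factor of its order is trivial. -/
lemma subsingleton_of_forall_prime_divisible {B : Type*} [AddCommGroup B] [Finite B]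
    (h : ∀ p : ℕ, p.Prime → p ∣ Nat.card B → ∀ b : B, ∃ b' : B, p • b' = b) :
    Subsingleton B := by
  by_contra hB
  rw [not_subsingleton_iff_nontrivial] at hB
  obtain ⟨p, hp, hpB⟩ := Nat.exists_prime_and_dvd (Finite.one_lt_card (α := B)).ne'
  have : Fact p.Prime := ⟨hp⟩
  obtain ⟨x, hx⟩ := exists_prime_addOrderOf_dvd_card' (G := B) p hpB
  have hinj : Function.Injective (fun b : B => p • b) :=
    Finite.injective_iff_surjective.2 (h p hp hpB)
  have hx0 : x = 0 := hinj (by simp [← hx, addOrderOf_nsmul_eq_zero])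
  rw [hx0, addOrderOf_zero] at hx
  exact hp.one_lt.ne hx

/-- If a finite abelian group is generated by `d` elements modulo every prime, then it is
generated by `d` elements. -/
lemma exists_generators_of_forall_prime {A : Type*} [AddCommGroup A] [Finite A] (d : ℕ)
    (h : ∀ p : ℕ, p.Prime → ∃ b : Fin d → A, AddSubgroup.closure (Set.range b) ⊔
      (nsmulAddMonoidHom (α := A) p).range = ⊤) :
    ∃ f : Fin d → A, AddSubgroup.closure (Set.range f) = ⊤ := by
  classical
  choose b hb using h
  let P := (Nat.card A).primeFactors
  -- `e p` is prime to `p` and divisible by the other primes of `P`, so `f i` is a unit multiple of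
  -- `b p i` modulo `p` for every `p` in `P` at once.
  let e : ℕ → ℕ := fun p => ∏ q ∈ P.erase p, q
  let f : Fin d → A := fun i => ∑ p ∈ P.attach,
    e p • b p (Nat.prime_of_mem_primeFactors p.2) i
  refine ⟨f, ?_⟩
  set B := AddSubgroup.closure (Set.range f)
  have key : ∀ p : ℕ, p.Prime → p ∣ Nat.card A →
      B ⊔ (nsmulAddMonoidHom (α := A) p).range = ⊤ := by
    intro p hp hpA
    have hpP : p ∈ P := Nat.mem_primeFactors.2 ⟨hp, hpA, Nat.card_pos.ne'⟩
    set T := B ⊔ (nsmulAddMonoidHom (α := A) p).range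
    have hpT : ∀ a : A, p • a ∈ T := fun a => AddSubgroup.mem_sup_right ⟨a, rfl⟩
    have hfT : ∀ i, f i ∈ T := fun i =>
      AddSubgroup.mem_sup_left (AddSubgroup.subset_closure ⟨i, rfl⟩)
    have hcop : Nat.Coprime (e p) p := by
      refine Nat.Coprime.prod_left fun q hq => ?_
      rw [Finset.mem_erase] at hq
      exact (Nat.coprime_primes (Nat.prime_of_mem_primeFactors hq.2) hp).2 hq.1
    have hbT : ∀ i, b p hp i ∈ T := by
      intro i
      have h1 : e p • b p hp i ∈ T := by
        have h2 : f i = e p • b p hp i + ∑ q ∈ P.attach.erase ⟨p, hpP⟩,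
            e q • b q (Nat.prime_of_mem_primeFactors q.2) i :=
          (Finset.add_sum_erase _ _ (Finset.mem_attach P ⟨p, hpP⟩)).symm
        have h3 : ∑ q ∈ P.attach.erase ⟨p, hpP⟩,
            e q • b q (Nat.prime_of_mem_primeFactors q.2) i ∈ T := by
          refine sum_mem fun q hq => ?_
          have hne : p ≠ q := fun h => (Finset.mem_erase.1 hq).1 (Subtype.ext h.symm)
          obtain ⟨k, hk⟩ : p ∣ e q :=
            Finset.dvd_prod_of_mem _ (Finset.mem_erase.2 ⟨hne, hpP⟩)
          rw [hk, mul_smul]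
          exact hpT _
        have h4 := sub_mem (hfT i) h3
        rwa [h2, add_sub_cancel_right] at h4
      have hbez : (1 : ℤ) = e p * Nat.gcdA (e p) p + p * Nat.gcdB (e p) p := by
        rw [← Nat.gcd_eq_gcd_ab, hcop.gcd_eq_one, Nat.cast_one]
      have h5 : b p hp i = Nat.gcdA (e p) p • (e p • b p hp i) +
          Nat.gcdB (e p) p • (p • b p hp i) := by
        conv_lhs => rw [← one_zsmul (b p hp i), hbez, add_smul, mul_comm, mul_smul,
          mul_comm (p : ℤ), mul_smul]
        simp
      rw [h5]
      exact add_mem (zsmul_mem h1 _) (zsmul_mem (hpT _) _)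
    rw [eq_top_iff, ← hb p hp, sup_le_iff]
    refine ⟨?_, le_sup_right⟩
    rw [AddSubgroup.closure_le]
    rintro _ ⟨i, rfl⟩
    exact hbT i
  have hsub : Subsingleton (A ⧸ B) := by
    refine subsingleton_of_forall_prime_divisible fun p hp hpc x => ?_
    induction x using QuotientAddGroup.induction_on with
    | H a =>
      have ha : a ∈ B ⊔ (nsmulAddMonoidHom (α := A) p).range := by
        rw [key p hp (hpc.trans (AddSubgroup.card_quotient_dvd_card B))]
        trivial
      obtain ⟨y, hy, _, ⟨z, rfl⟩, rfl⟩ := AddSubgroup.mem_sup.1 ha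
      refine ⟨(z : A ⧸ B), ?_⟩
      rw [QuotientAddGroup.mk_add, (QuotientAddGroup.eq_zero_iff y).2 hy, zero_add]
      rfl
  rwa [QuotientAddGroup.subsingleton_iff] at hsub

/-- A generating set of a finite abelian group contains, for some prime `p`, as many elements
independent modulo `p` as are needed to generate the group. -/
lemma exists_prime_exists_independent_mod {A : Type*} [AddCommGroup A] [Finite A] (S : Set A)
    (hS : AddSubgroup.closure S = ⊤) (r : ℕ)
    (hr : ∀ (d : ℕ) (f : Fin d → A), AddSubgroup.closure (Set.range f) = ⊤ → r ≤ d) :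
    ∃ p : ℕ, p.Prime ∧ ∃ x : Fin r → A, (∀ i, x i ∈ S) ∧
      ∀ c : Fin r → ℤ, ∑ i, c i • x i = 0 → ∀ i, (p : ℤ) ∣ c i := by
  classical
  rcases Nat.eq_zero_or_pos r with rfl | hr0
  · exact ⟨2, Nat.prime_two, Fin.elim0, fun i => i.elim0, fun _ _ i => i.elim0⟩
  have hspan : ∀ p : ℕ, Submodule.span (ZMod p) (ModN.mkQ p '' S) = ⊤ := by
    intro p
    rw [eq_top_iff]
    rintro x -
    obtain ⟨a, rfl⟩ := Submodule.mkQ_surjective _ x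
    have ha : a ∈ AddSubgroup.closure S := hS ▸ trivial
    induction ha using AddSubgroup.closure_induction with
    | mem y hy => exact Submodule.subset_span ⟨y, hy, rfl⟩
    | zero => rw [map_zero]; exact zero_mem _
    | add y z _ _ h1 h2 => rw [map_add]; exact add_mem h1 h2
    | neg y _ h1 => rw [map_neg]; exact neg_mem h1
  by_cases hex : ∃ p : ℕ, p.Prime ∧
      ∃ t ⊆ ModN.mkQ (G := A) p '' S, LinearIndepOn (ZMod p) id t ∧ r ≤ t.ncard
  · obtain ⟨p, hp, t, htS, hti, hrt⟩ := hex
    have : Fact p.Prime := ⟨hp⟩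
    refine ⟨p, hp, ?_⟩
    have : Finite (ModN A p) := Finite.of_surjective _ (Submodule.mkQ_surjective _)
    have : Fintype t := Fintype.ofFinite t
    have hcard : Fintype.card (Fin r) ≤ Fintype.card t := by
      rwa [Fintype.card_fin, ← Nat.card_eq_fintype_card]
    obtain ⟨ε⟩ := Function.Embedding.nonempty_of_card_le hcard
    choose x hx using fun i => htS (ε i).2
    refine ⟨x, fun i => (hx i).1, fun c hc i => ?_⟩
    have hli : LinearIndependent (ZMod p) fun i => ((ε i : t) : ModN A p) :=
      hti.comp ε ε.injective
    have h0 := Fintype.linearIndependent_iff.1 hli (fun i => (c i : ZMod p)) (by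
      have := congrArg (ModN.mkQ p) hc
      rw [map_sum, map_zero] at this
      rw [← this]
      refine Finset.sum_congr rfl fun i _ => ?_
      rw [map_zsmul, (hx i).2, Int.cast_smul_eq_zsmul]) i
    exact (ZMod.intCast_zmod_eq_zero_iff_dvd _ _).1 h0
  -- Otherwise every `A/pA` is spanned by at most `r - 1` images of elements of `S`, and `A` would
  -- be generated by `r - 1` elements.
  · exfalso
    push Not at hex
    obtain ⟨f, hf⟩ := exists_generators_of_forall_prime (A := A) (r - 1) (by
      intro p hp
      have : Fact p.Prime := ⟨hp⟩
      obtain ⟨t, htS, htspan, hti⟩ := exists_linearIndependent (ZMod p) (ModN.mkQ (G := A) p '' S)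
      have hlt := hex p hp t htS hti
      have : Finite (ModN A p) := Finite.of_surjective _ (Submodule.mkQ_surjective _)
      have : Fintype t := Fintype.ofFinite t
      have hcard : Fintype.card t ≤ Fintype.card (Fin (r - 1)) := by
        rw [Fintype.card_fin, ← Nat.card_eq_fintype_card]
        change t.ncard ≤ _
        omega
      obtain ⟨ε⟩ := Function.Embedding.nonempty_of_card_le hcard
      choose y hy using fun i : t => htS i.2
      let b : Fin (r - 1) → A := Function.extend ε y 0
      have hb : ∀ i, b (ε i) = y i := fun i => ε.injective.extend_apply _ _ _
      refine ⟨b, eq_top_iff.2 fun a _ => ?_⟩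
      have ha : ModN.mkQ p a ∈ Submodule.span (ZMod p) t := by
        rw [htspan, hspan]; trivial
      have hlift : ∀ z ∈ Submodule.span (ZMod p) t,
          ∃ a ∈ AddSubgroup.closure (Set.range b), ModN.mkQ p a = z := by
        intro z hz
        induction hz using Submodule.span_induction with
        | mem z hz =>
          exact ⟨y ⟨z, hz⟩, AddSubgroup.subset_closure ⟨ε ⟨z, hz⟩, hb _⟩, (hy ⟨z, hz⟩).2⟩
        | zero => exact ⟨0, zero_mem _, map_zero _⟩
        | add z w _ _ hz hw =>
          obtain ⟨a, ha, rfl⟩ := hz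
          obtain ⟨c, hc, rfl⟩ := hw
          exact ⟨a + c, add_mem ha hc, map_add _ _ _⟩
        | smul k z _ hz =>
          obtain ⟨a, ha, rfl⟩ := hz
          refine ⟨k.val • a, nsmul_mem ha _, ?_⟩
          rw [map_nsmul, ← Nat.cast_smul_eq_nsmul (ZMod p), ZMod.natCast_zmod_val]
      obtain ⟨a', ha', heq⟩ := hlift _ ha
      rw [← add_sub_cancel a' a]
      refine AddSubgroup.add_mem_sup ha' ?_
      have : a - a' ∈ LinearMap.range (LinearMap.lsmul ℤ A p) :=
        (Submodule.Quotient.eq _).1 heq.symm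
      obtain ⟨w, hw⟩ := this
      refine ⟨w, ?_⟩
      rw [← hw]
      simp)
    have := hr _ f hf
    omega

/-! ### Linear independence of exponents and algebraic independence -/

/-- Integer vectors whose images under a weight map are independent modulo a prime are linearly
independent. -/
lemma eq_zero_of_independent_mod {A : Type*} [AddCommGroup A] {ι σ : Type*} [Fintype ι]
    [Fintype σ] {p : ℕ} (hp : p.Prime) (wt : σ → A) (a : ι → σ → ℤ)
    (h : ∀ c : ι → ℤ, ∑ i, c i • ∑ s, a i s • wt s = 0 → ∀ i, (p : ℤ) ∣ c i)
    (c : ι → ℤ) (hc : ∀ s, ∑ i, c i * a i s = 0) : c = 0 := by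
  have step : ∀ c : ι → ℤ, (∀ s, ∑ i, c i * a i s = 0) → ∀ i, (p : ℤ) ∣ c i := by
    intro c hc
    refine h c ?_
    simp_rw [Finset.smul_sum, smul_smul]
    rw [Finset.sum_comm]
    refine Finset.sum_eq_zero fun s _ => ?_
    rw [← Finset.sum_smul, hc, zero_smul]
  -- Infinite descent: a relation divided by `p` is again a relation.
  have hpow : ∀ k : ℕ, ∀ c : ι → ℤ, (∀ s, ∑ i, c i * a i s = 0) → ∀ i, (p : ℤ) ^ k ∣ c i := by
    intro k
    induction k with
    | zero => simp
    | succ k ih =>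
      intro c hc i
      choose c' hc' using step c hc
      have : ∀ s, ∑ i, c' i * a i s = 0 := by
        intro s
        have h1 := hc s
        simp_rw [hc', mul_assoc, ← Finset.mul_sum] at h1
        exact (mul_eq_zero.1 h1).resolve_left (by exact_mod_cast hp.ne_zero)
      rw [hc' i, pow_succ']
      exact mul_dvd_mul_left _ (ih c' this i)
  funext i
  by_contra hne
  have hfin : FiniteMultiplicity (p : ℤ) (c i) :=
    Int.finiteMultiplicity_iff.2 ⟨by simpa using hp.ne_one, hne⟩
  obtain ⟨n, hn⟩ := hfin
  exact hn (hpow _ c hc i)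

open MvPolynomial in
/-- Nonzero polynomials whose leading exponents are linearly independent are algebraically
independent. -/
lemma MonomialOrder.algebraicIndependent_of_degree {K σ ι : Type*} [Field K] [Fintype ι]
    (m : MonomialOrder σ) (f : ι → MvPolynomial σ K) (hf : ∀ i, f i ≠ 0)
    (hinj : ∀ α β : ι →₀ ℕ, ∑ i, α i • m.degree (f i) = ∑ i, β i • m.degree (f i) → α = β) :
    AlgebraicIndependent K f := by
  rw [algebraicIndependent_iff]
  intro P hP
  by_contra hne
  obtain ⟨α, hα, hmax⟩ := P.support.exists_max_image
    (fun α => m.toSyn (∑ i, α i • m.degree (f i))) (support_nonempty.2 hne)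
  have hterm : ∀ β : ι →₀ ℕ, m.degree (∏ i, f i ^ β i) = ∑ i, β i • m.degree (f i) := by
    intro β
    rw [m.degree_prod fun i _ => pow_ne_zero _ (hf i)]
    exact Finset.sum_congr rfl fun i _ => m.degree_pow _ _
  -- By `hinj` distinct terms of `P` have distinct leading exponents, so nothing cancels the largest
  -- one.
  have hcoeff : coeff (∑ i, α i • m.degree (f i)) (aeval f P) =
      P.coeff α * m.leadingCoeff (∏ i, f i ^ α i) := by
    rw [aeval_def, eval₂_eq, coeff_sum, Finset.sum_eq_single_of_mem α hα]
    · rw [algebraMap_eq, coeff_C_mul, Finset.prod_subset (Finset.subset_univ _)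
        (fun i _ hi => by rw [Finsupp.notMem_support_iff.1 hi, pow_zero]),
        MonomialOrder.leadingCoeff, hterm]
    · intro β hβ hβα
      rw [algebraMap_eq, coeff_C_mul, Finset.prod_subset (Finset.subset_univ _)
        (fun i _ hi => by rw [Finsupp.notMem_support_iff.1 hi, pow_zero]),
        m.coeff_eq_zero_of_lt, mul_zero]
      rw [hterm]
      refine lt_of_le_of_ne (hmax β hβ) fun h => hβα (hinj _ _ (m.toSyn.injective h))
  rw [hP, coeff_zero] at hcoeff
  refine mul_ne_zero (mem_support_iff.1 hα) (m.leadingCoeff_ne_zero_iff.2 ?_) hcoeff.symm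
  exact Finset.prod_ne_zero_iff.2 fun i _ => pow_ne_zero _ (hf i)

/-! ### Lower bounds for the Krull dimension -/

/-- The Krull dimension does not drop under injective integral extensions. -/
lemma ringKrullDim_le_of_isIntegral_of_injective {R S : Type*} [CommRing R] [CommRing S]
    [Algebra R S] [Algebra.IsIntegral R S] (h : Function.Injective (algebraMap R S)) :
    ringKrullDim R ≤ ringKrullDim S := by
  refine iSup_le fun l => ?_
  have : FaithfulSMul R S := (faithfulSMul_iff_algebraMap_injective R S).2 h
  -- Lying over gives a prime above the bottom of the chain; going up lifts the rest.
  obtain ⟨⟨Q, hQ, hQl⟩⟩ := Ideal.nonempty_primesOver (S := S) (RelSeries.head l).asIdeal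
  obtain ⟨L, hL, -⟩ := Ideal.exists_ltSeries_of_hasGoingUp l Q
  rw [← hL]
  exact Order.LTSeries.length_le_krullDim L

/-- A finitely generated domain over a field with `r` algebraically independent elements has Krull
dimension at least `r`. -/
lemma AlgebraicIndependent.le_ringKrullDim {K A : Type*} [Field K] [CommRing A] [IsDomain A]
    [Algebra K A] [Algebra.FiniteType K A] {r : ℕ} {f : Fin r → A}
    (hf : AlgebraicIndependent K f) : (r : WithBot ℕ∞) ≤ ringKrullDim A := by
  obtain ⟨s, g, hg, hint⟩ := exists_integral_inj_algHom_of_fg K A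
  -- `A` is algebraic over a subalgebra with `s` generators, so its transcendence degree is at most
  -- `s`.
  have hr : r ≤ s := by
    have h1 : AlgebraicIndependent K (fun i => g (MvPolynomial.X i)) :=
      (MvPolynomial.algebraicIndependent_X (Fin s) K).map' hg
    have h2 : Algebra.IsIntegral (Algebra.adjoin K (Set.range fun i => g (MvPolynomial.X i))) A := by
      refine ⟨fun a => ?_⟩
      obtain ⟨P, hP, hPa⟩ := hint a
      have hmem : ∀ q, g q ∈ Algebra.adjoin K (Set.range fun i => g (MvPolynomial.X i)) := by
        intro q
        rw [Algebra.adjoin_range_eq_range_aeval]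
        refine ⟨q, ?_⟩
        have h : MvPolynomial.aeval (fun i => g (MvPolynomial.X i)) = g :=
          MvPolynomial.algHom_ext fun i => MvPolynomial.aeval_X _ i
        exact DFunLike.congr_fun h q
      refine ⟨P.map (g.codRestrict _ hmem).toRingHom, hP.map _, ?_⟩
      rw [Polynomial.eval₂_map]
      exact hPa
    have h3 : Algebra.trdeg K A ≤ Cardinal.mk (Set.range fun i => g (MvPolynomial.X i)) :=
      Algebra.IsAlgebraic.trdeg_le_cardinalMk K _
    have h4 := hf.lift_cardinalMk_le_trdeg.trans (Cardinal.lift_le.2 h3)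
    have h5 : Cardinal.mk (Set.range fun i => g (MvPolynomial.X i)) ≤ s := by
      have := Cardinal.mk_range_le_lift (f := fun i : Fin s => g (MvPolynomial.X i))
      simpa using this
    have h6 := h4.trans (Cardinal.lift_le.2 h5)
    simpa using h6
  calc (r : WithBot ℕ∞) ≤ s := by exact_mod_cast hr
    _ = ringKrullDim (MvPolynomial (Fin s) K) := by
      rw [MvPolynomial.ringKrullDim_of_isNoetherianRing, ringKrullDim_eq_zero_of_field]
      simp
    _ ≤ ringKrullDim A := by
      algebraize [g.toRingHom]
      have : Algebra.IsIntegral (MvPolynomial (Fin s) K) A := ⟨hint⟩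
      exact ringKrullDim_le_of_isIntegral_of_injective hg

/-! ### Polynomial functions and coordinate rings -/

section PolynomialFunctions

variable {V W ι : Type*} [AddCommGroup V] [Module ℂ V] [AddCommGroup W] [Module ℂ W]

/-- Evaluation of polynomials at a family of linear functionals. -/
noncomputable def polyEval (b : ι → Module.Dual ℂ V) : MvPolynomial ι ℂ →ₐ[ℂ] (V → ℂ) :=
  MvPolynomial.aeval fun i v => b i v

lemma polyEval_apply (b : ι → Module.Dual ℂ V) (P : MvPolynomial ι ℂ) (v : V) :
    polyEval b P v = MvPolynomial.eval (fun i => b i v) P := by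
  have h : (Pi.evalAlgHom ℂ (fun _ : V => ℂ) v).comp (polyEval b) =
      MvPolynomial.aeval fun i => b i v :=
    MvPolynomial.algHom_ext fun i => by simp [polyEval]
  exact DFunLike.congr_fun h P

lemma polyFun_eq_range (b : ι → Module.Dual ℂ V) (hb : Submodule.span ℂ (Set.range b) = ⊤) :
    polyFun V = (polyEval b).range := by
  rw [polyEval, ← Algebra.adjoin_range_eq_range_aeval, polyFun]
  refine le_antisymm (Algebra.adjoin_le ?_) (Algebra.adjoin_mono ?_)
  · rintro _ ⟨l, rfl⟩
    have hl : l ∈ Submodule.span ℂ (Set.range b) := hb ▸ Submodule.mem_top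
    induction hl using Submodule.span_induction with
    | mem l hl =>
      obtain ⟨i, rfl⟩ := hl
      exact Algebra.subset_adjoin ⟨i, rfl⟩
    | zero => exact zero_mem _
    | add l m _ _ hl hm => exact add_mem hl hm
    | smul c l _ hl => exact Subalgebra.smul_mem _ hl c
  · rintro _ ⟨i, rfl⟩
    exact ⟨b i, rfl⟩

/-- By reflexivity every tuple of values of the basis functionals occurs at a point of `V`, and a
polynomial over an infinite field is determined by its values. -/
lemma polyEval_injective [FiniteDimensional ℂ V] (b : Module.Basis ι ℂ (Module.Dual ℂ V)) :
    Function.Injective (polyEval b) := by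
  intro P Q h
  refine MvPolynomial.funext fun c => ?_
  have hv : (fun i => b i ((Module.evalEquiv ℂ V).symm (b.constr ℂ c))) = c := by
    funext i
    rw [Module.apply_evalEquiv_symm_apply, b.constr_basis]
  rw [← hv, ← polyEval_apply, ← polyEval_apply, h]

lemma IsPolyMorphism.comp_mem {φ : V → W} (hφ : IsPolyMorphism φ) {F : W → ℂ}
    (hF : F ∈ polyFun W) : (fun v => F (φ v)) ∈ polyFun V := by
  induction hF using Algebra.adjoin_induction with
  | mem F hF =>
    obtain ⟨l, rfl⟩ := hF
    exact hφ l
  | algebraMap c => exact Subalgebra.algebraMap_mem _ c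
  | add F F' _ _ h h' => exact add_mem h h'
  | mul F F' _ _ h h' => exact mul_mem h h'

lemma coordRing_eq_range (b : ι → Module.Dual ℂ W) (hb : Submodule.span ℂ (Set.range b) = ⊤)
    (X : Set W) : coordRing X = ((restrictFun X).comp (polyEval b)).range := by
  rw [coordRing, polyFun_eq_range b hb, AlgHom.range_comp]

instance [FiniteDimensional ℂ W] (X : Set W) : Algebra.FiniteType ℂ (coordRing X) := by
  have b := Module.finBasis ℂ (Module.Dual ℂ W)
  rw [coordRing_eq_range b b.span_eq]
  exact Algebra.FiniteType.of_surjective _ (AlgHom.rangeRestrict_surjective _)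

lemma varietyDim_le [Fintype ι] (b : ι → Module.Dual ℂ W)
    (hb : Submodule.span ℂ (Set.range b) = ⊤) (X : Set W) :
    varietyDim X ≤ Fintype.card ι := by
  rw [varietyDim, coordRing_eq_range b hb]
  refine (ringKrullDim_le_of_surjective _
    (AlgHom.rangeRestrict_surjective ((restrictFun X).comp (polyEval b)))).trans ?_
  rw [MvPolynomial.ringKrullDim_of_isNoetherianRing, ringKrullDim_eq_zero_of_field]
  simp

lemma subset_zariskiClosure (S : Set W) : S ⊆ zariskiClosure S := fun s hs _ _ h => h s hs

/-- The pullback of functions along `φ`, on the coordinate ring of the closure of the image. -/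
noncomputable def coordPullback (φ : V → W) :
    coordRing (zariskiClosure (Set.range φ)) →ₐ[ℂ] (V → ℂ) :=
  (AlgHom.pi fun v : V => Pi.evalAlgHom ℂ (fun _ : zariskiClosure (Set.range φ) => ℂ)
    ⟨φ v, subset_zariskiClosure _ ⟨v, rfl⟩⟩).comp (Subalgebra.val _)

omit [AddCommGroup V] [Module ℂ V] in
lemma coordPullback_injective (φ : V → W) : Function.Injective (coordPullback φ) := by
  rw [injective_iff_map_eq_zero]
  rintro ⟨_, F, hF, rfl⟩ h
  refine Subtype.ext (funext fun x => ?_)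
  refine x.2 F hF ?_
  rintro _ ⟨v, rfl⟩
  exact congrFun h v

lemma coordPullback_mem {φ : V → W} (hφ : IsPolyMorphism φ)
    (F : coordRing (zariskiClosure (Set.range φ))) : coordPullback φ F ∈ polyFun V := by
  obtain ⟨_, F, hF, rfl⟩ := F
  exact hφ.comp_mem hF

/-- Pullback embeds this ring into the polynomial functions on `V`, which form a polynomial ring. -/
lemma IsPolyMorphism.isDomain_coordRing [FiniteDimensional ℂ V] {φ : V → W}
    (hφ : IsPolyMorphism φ) : IsDomain (coordRing (zariskiClosure (Set.range φ))) := by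
  have b := Module.finBasis ℂ (Module.Dual ℂ V)
  have : Nontrivial (coordRing (zariskiClosure (Set.range φ))) := by
    refine ⟨0, 1, fun h => ?_⟩
    have h1 := congrFun (congrArg (coordPullback φ) h) 0
    rw [map_zero, map_one] at h1
    exact zero_ne_one h1
  have : NoZeroDivisors (coordRing (zariskiClosure (Set.range φ))) := by
    refine ⟨fun {F F'} h => ?_⟩
    have hF := coordPullback_mem hφ F
    have hF' := coordPullback_mem hφ F'
    rw [polyFun_eq_range b b.span_eq] at hF hF'
    obtain ⟨P, hP⟩ := hF
    obtain ⟨Q, hQ⟩ := hF'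
    have hPQ : P * Q = 0 := polyEval_injective b (by
      rw [map_mul, map_zero]
      refine (congrArg₂ (· * ·) hP hQ).trans ?_
      rw [← map_mul, h, map_zero])
    rcases mul_eq_zero.1 hPQ with rfl | rfl
    · exact .inl (coordPullback_injective φ (hP.symm.trans (by simp)))
    · exact .inr (coordPullback_injective φ (hQ.symm.trans (by simp)))
  exact NoZeroDivisors.to_isDomain _

end PolynomialFunctions

/-! ### Weights of functionals and polynomials -/

section Characters

variable {G V : Type*} [CommGroup G] [Finite G] [AddCommGroup V] [Module ℂ V]

instance : Finite (G →* ℂˣ) :=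
  .of_equiv G (CommGroup.monoidHom_mulEquiv_of_hasEnoughRootsOfUnity G ℂ).some.symm.toEquiv

lemma sum_monoidHom_apply_eq_zero [Fintype (G →* ℂˣ)] {g : G} (hg : g ≠ 1) :
    ∑ χ : G →* ℂˣ, (χ g : ℂ) = 0 := by
  obtain ⟨ψ, hψ⟩ := CommGroup.exists_apply_ne_one_of_hasEnoughRootsOfUnity G ℂ hg
  refine eq_zero_of_mul_eq_self_left (b := (ψ g : ℂ)) (by simpa using hψ) ?_
  rw [Finset.mul_sum]
  exact Fintype.sum_bijective _ (Group.mulLeft_bijective ψ) _ _ fun χ => by simp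

/-- The functional `l` is semi-invariant of weight `χ`. -/
def IsSemiInvariant (ρ : Representation ℂ G V) (χ : G →* ℂˣ) (l : Module.Dual ℂ V) : Prop :=
  ∀ g v, l (ρ g v) = χ g * l v

/-- Averaging `l` against `χ⁻¹` gives a functional `L χ` of weight `χ`; by orthogonality of
characters the `L χ` sum to a nonzero multiple of `l`. -/
lemma span_isSemiInvariant (ρ : Representation ℂ G V) :
    Submodule.span ℂ {l | ∃ χ, IsSemiInvariant ρ χ l} = ⊤ := by
  classical
  have : Fintype G := Fintype.ofFinite G
  have : Fintype (G →* ℂˣ) := Fintype.ofFinite _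
  rw [eq_top_iff]
  rintro l -
  let L : (G →* ℂˣ) → Module.Dual ℂ V := fun χ => ∑ h : G, ((χ h⁻¹ : ℂˣ) : ℂ) • l.comp (ρ h)
  have hL : ∀ χ, IsSemiInvariant ρ χ (L χ) := by
    intro χ g v
    simp only [L, LinearMap.sum_apply, LinearMap.smul_apply, LinearMap.comp_apply, smul_eq_mul,
      Finset.mul_sum]
    refine Fintype.sum_bijective _ (Group.mulRight_bijective g) _ _ fun h => ?_
    rw [map_mul ρ, mul_inv_rev, map_mul, Units.val_mul, ← mul_assoc, ← mul_assoc, ← Units.val_mul,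
      ← map_mul, mul_inv_cancel, map_one, Units.val_one, one_mul]
    rfl
  have hsum : ∑ χ, L χ = (Fintype.card (G →* ℂˣ) : ℂ) • l := by
    simp only [L]
    rw [Finset.sum_comm, Finset.sum_eq_single_of_mem 1 (Finset.mem_univ _)]
    · simp only [inv_one, map_one, Units.val_one, one_smul, Finset.sum_const, Finset.card_univ]
      rw [← Nat.cast_smul_eq_nsmul ℂ]
      rfl
    · intro h _ hh
      rw [← Finset.sum_smul, sum_monoidHom_apply_eq_zero (inv_ne_one.2 hh), zero_smul]
  have hl : l = (Fintype.card (G →* ℂˣ) : ℂ)⁻¹ • ∑ χ, L χ := by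
    rw [hsum, smul_smul, inv_mul_cancel₀ (by simp), one_smul]
  rw [hl]
  exact Submodule.smul_mem _ _ (sum_mem fun χ _ => Submodule.subset_span ⟨χ, hL χ⟩)

lemma exists_basis_isSemiInvariant [FiniteDimensional ℂ V] (ρ : Representation ℂ G V) :
    ∃ (n : ℕ) (b : Module.Basis (Fin n) ℂ (Module.Dual ℂ V)) (wt : Fin n → (G →* ℂˣ)),
      ∀ i, IsSemiInvariant ρ (wt i) (b i) := by
  let b := Module.Basis.ofSpan (span_isSemiInvariant ρ).ge
  have : Finite _ := Module.Finite.finite_basis b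
  let e := Finite.equivFin ((linearIndepOn_empty ℂ id).extend
    (Set.empty_subset {l | ∃ χ, IsSemiInvariant ρ χ l}))
  have h : ∀ i, ∃ χ, IsSemiInvariant ρ χ (b.reindex e i) := by
    intro i
    rw [Module.Basis.reindex_apply]
    exact Module.Basis.ofSpan_subset (span_isSemiInvariant ρ).ge ⟨_, rfl⟩
  choose wt hwt using h
  exact ⟨_, b.reindex e, wt, hwt⟩

open MvPolynomial in
lemma coeff_aeval_C_mul_X {R σ : Type*} [CommRing R] [Fintype σ] (c : σ → R)
    (P : MvPolynomial σ R) (α : σ →₀ ℕ) :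
    coeff α (aeval (fun i => C (c i) * X i) P) = (∏ i, c i ^ α i) * coeff α P := by
  classical
  induction P using MvPolynomial.induction_on' with
  | add P Q hP hQ => rw [map_add, coeff_add, hP, hQ, coeff_add, mul_add]
  | monomial β a =>
    have h : aeval (fun i => C (c i) * X i) (monomial β a) =
        C (∏ i, c i ^ β i) * monomial β a := by
      rw [aeval_monomial, Finsupp.prod_fintype _ _ (by simp), algebraMap_eq, monomial_eq,
        Finsupp.prod_fintype _ _ (by simp)]
      simp_rw [mul_pow, Finset.prod_mul_distrib, map_prod, map_pow]
      ring
    rw [h, coeff_C_mul, coeff_monomial]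
    split_ifs with hβ
    · rw [hβ]
    · simp

omit [Finite G] in
/-- The exponents of a semi-invariant polynomial function have the weight of the function. -/
lemma prod_weight_eq_of_mem_support [FiniteDimensional ℂ V] (ρ : Representation ℂ G V) {n : ℕ}
    (b : Module.Basis (Fin n) ℂ (Module.Dual ℂ V)) (wt : Fin n → (G →* ℂˣ))
    (hb : ∀ i, IsSemiInvariant ρ (wt i) (b i)) (P : MvPolynomial (Fin n) ℂ) (χ : G →* ℂˣ)
    (hP : ∀ g v, polyEval b P (ρ g v) = χ g * polyEval b P v) {α : Fin n →₀ ℕ}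
    (hα : α ∈ P.support) : ∏ i, wt i ^ α i = χ := by
  ext g
  -- The action of `g` scales each variable by its weight, so both sides can be compared monomial by
  -- monomial.
  have hpoly : MvPolynomial.aeval (fun i => MvPolynomial.C (wt i g : ℂ) * MvPolynomial.X i) P =
      MvPolynomial.C (χ g : ℂ) * P := by
    refine polyEval_injective b (funext fun v => ?_)
    rw [map_mul, Pi.mul_apply, polyEval_apply _ (MvPolynomial.C _), MvPolynomial.eval_C, ← hP,
      polyEval_apply, polyEval_apply]
    have h := MvPolynomial.comp_aeval_apply
      (fun i => MvPolynomial.C (wt i g : ℂ) * MvPolynomial.X i)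
      (MvPolynomial.aeval fun i => b i v) P
    simp only [MvPolynomial.aeval_eq_eval, map_mul, MvPolynomial.eval_C,
      MvPolynomial.eval_X] at h
    simp_rw [hb _ g v]
    exact h
  have h := congrArg (MvPolynomial.coeff α) hpoly
  rw [coeff_aeval_C_mul_X, MvPolynomial.coeff_C_mul] at h
  have h' := mul_right_cancel₀ (MvPolynomial.mem_support_iff.1 hα) h
  rw [← h']
  simp

end Characters

/-! ### Duality with the character group -/

section Duality

variable {G : Type*} [CommGroup G] [Finite G]

/-- A set of characters that separates the points of a finite abelian group generates the group
of characters. -/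
lemma closure_eq_top_of_separates (S : Set (G →* ℂˣ))
    (hS : ∀ g : G, (∀ χ ∈ S, χ g = 1) → g = 1) : Subgroup.closure S = ⊤ := by
  -- This order-reversing bijection matches a group of characters with its common kernel in `G`.
  let e := CommGroup.subgroupOrderIsoSubgroupMonoidHom G ℂ
  have h : e.symm (OrderDual.toDual (Subgroup.closure S)) = ⊥ := by
    rw [eq_bot_iff]
    intro g hg
    rw [CommGroup.mem_subgroupOrderIsoSubgroupMonoidHom_symm_iff] at hg
    exact hS g fun χ hχ => hg χ (Subgroup.subset_closure hχ)
  rw [OrderIso.symm_apply_eq, map_bot] at h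
  exact OrderDual.toDual.injective h

lemma rank_monoidHom : Group.rank (G →* ℂˣ) = Group.rank G :=
  Group.rank_congr (CommGroup.monoidHom_mulEquiv_of_hasEnoughRootsOfUnity G ℂ).some

/-- An element killed by a generating set of characters is killed by all characters, hence trivial.
-/
lemma exists_separating_family :
    ∃ χ : Fin (Group.rank G) → (G →* ℂˣ), ∀ g : G, (∀ i, χ i g = 1) → g = 1 := by
  obtain ⟨S, hS, hgen⟩ := Group.rank_spec (G →* ℂˣ)
  rw [rank_monoidHom] at hS
  refine ⟨fun i => (S.equivFinOfCardEq hS).symm i, fun g hg => ?_⟩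
  by_contra hne
  obtain ⟨ψ, hψ⟩ := CommGroup.exists_apply_ne_one_of_hasEnoughRootsOfUnity G ℂ hne
  have hle : Subgroup.closure (S : Set (G →* ℂˣ)) ≤ (MonoidHom.eval g).ker := by
    rw [Subgroup.closure_le]
    intro χ hχ
    have h := hg (S.equivFinOfCardEq hS ⟨χ, hχ⟩)
    beta_reduce at h
    rwa [Equiv.symm_apply_apply] at h
  rw [hgen] at hle
  exact hψ (hle (Subgroup.mem_top ψ))

end Duality

/-! ### The lower and upper bounds -/

/-- The image of a faithful covariant of a finite abelian group has dimension at least the rank of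
the group. -/
theorem IsCovariant.rank_le_mapDim {G V W : Type*} [CommGroup G] [Finite G]
    [AddCommGroup V] [Module ℂ V] [FiniteDimensional ℂ V]
    [AddCommGroup W] [Module ℂ W] [FiniteDimensional ℂ W]
    {ρ : Representation ℂ G V} {σ : Representation ℂ G W} {φ : V → W}
    (hφ : IsCovariant ρ σ φ) (hfaith : FaithfulOnImage σ φ) :
    (Group.rank G : WithBot ℕ∞) ≤ mapDim φ := by
  let S : Set (G →* ℂˣ) := {χ | ∃ l, IsSemiInvariant σ χ l ∧ ∃ v, l (φ v) ≠ 0}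
  -- If the weights in `S` are trivial at `g`, no semi-invariant functional tells `σ g (φ v)` from
  -- `φ v`, and these functionals span the dual.
  have hsep : ∀ g : G, (∀ χ ∈ S, χ g = 1) → g = 1 := by
    intro g hg
    refine hfaith g ?_
    rintro _ ⟨v, rfl⟩
    rw [← sub_eq_zero, ← Module.forall_dual_apply_eq_zero_iff ℂ]
    intro l
    have hl : l ∈ Submodule.span ℂ {l | ∃ χ, IsSemiInvariant σ χ l} := by
      rw [span_isSemiInvariant]
      trivial
    induction hl using Submodule.span_induction with
    | mem l hl =>
      obtain ⟨χ, hχ⟩ := hl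
      rw [map_sub, hχ]
      by_cases h0 : l (φ v) = 0
      · simp [h0]
      · simp [hg χ ⟨l, hχ, v, h0⟩]
    | zero => rfl
    | add l m _ _ hl hm => rw [LinearMap.add_apply, hl, hm, add_zero]
    | smul c l _ hl => rw [LinearMap.smul_apply, hl, smul_zero]
  have hgen : AddSubgroup.closure (Additive.toMul ⁻¹' S) = ⊤ := by
    rw [← Subgroup.toAddSubgroup_closure, closure_eq_top_of_separates S hsep]
    rfl
  obtain ⟨p, hp, x, hxS, hx⟩ := exists_prime_exists_independent_mod
    (A := Additive (G →* ℂˣ)) _ hgen (Group.rank G) (by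
      classical
      intro d f hf
      have hf' : Subgroup.closure ((Finset.univ.image fun i => (f i).toMul : Finset (G →* ℂˣ)) :
          Set (G →* ℂˣ)) = ⊤ := by
        apply Subgroup.toAddSubgroup.injective
        rw [Subgroup.toAddSubgroup_closure, Finset.coe_image, Finset.coe_univ, Set.image_univ]
        exact hf
      rw [← rank_monoidHom]
      refine (Group.rank_le hf').trans (Finset.card_image_le.trans ?_)
      simp)
  choose l hl v hv using hxS
  obtain ⟨n, b, wt, hb⟩ := exists_basis_isSemiInvariant ρ
  have hpoly : ∀ i, ∃ P, polyEval b P = fun v => l i (φ v) := by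
    intro i
    have h := hφ.morphism (l i)
    rw [polyFun_eq_range b b.span_eq] at h
    exact h
  choose P hP using hpoly
  have hP0 : ∀ i, P i ≠ 0 := by
    intro i h
    refine hv i ?_
    have h1 := congrFun (hP i) (v i)
    rw [h, map_zero] at h1
    exact h1.symm
  let m : MonomialOrder (Fin n) := MonomialOrder.lex
  have hwt : ∀ i, ∑ s, (m.degree (P i) s : ℤ) • Additive.ofMul (wt s) = x i := by
    intro i
    have h := prod_weight_eq_of_mem_support ρ b wt hb (P i) (x i).toMul (fun g v => by
      rw [hP]
      simp only [hφ.equivariant]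
      exact hl i g (φ v)) (m.degree_mem_support (hP0 i))
    have h1 := congrArg Additive.ofMul h
    rw [ofMul_prod] at h1
    rw [← ofMul_toMul (x i), ← h1]
    exact Finset.sum_congr rfl fun s _ => natCast_zsmul _ _
  -- The leading exponent of `P i` has weight `x i`, so independence of the `x i` modulo `p` passes
  -- to the exponents.
  have halg : AlgebraicIndependent ℂ P := by
    refine m.algebraicIndependent_of_degree P hP0 fun α β hαβ => ?_
    have h0 := eq_zero_of_independent_mod hp (fun s => Additive.ofMul (wt s))
      (fun i s => (m.degree (P i) s : ℤ)) (by simpa only [hwt] using hx)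
      (fun i => (α i : ℤ) - β i) (fun s => by
        have h := DFunLike.congr_fun hαβ s
        simp only [Finsupp.coe_finsetSum, Finset.sum_apply, Finsupp.smul_apply,
          smul_eq_mul] at h
        simp_rw [sub_mul, Finset.sum_sub_distrib]
        rw [sub_eq_zero]
        exact_mod_cast h)
    ext i
    have h := congrFun h0 i
    simp only [Pi.zero_apply] at h
    omega
  let F : Fin (Group.rank G) → coordRing (zariskiClosure (Set.range φ)) := fun i =>
    ⟨restrictFun _ fun w => l i w, _, Algebra.subset_adjoin ⟨l i, rfl⟩, rfl⟩
  have hF : AlgebraicIndependent ℂ F := by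
    refine AlgebraicIndependent.of_comp (coordPullback φ) ?_
    have h : ⇑(coordPullback φ) ∘ F = polyEval b ∘ P := by
      funext i
      exact (hP i).symm
    rw [h]
    exact halg.map' (polyEval_injective b)
  have := hφ.morphism.isDomain_coordRing
  exact hF.le_ringKrullDim

/-- The diagonal representation of a family of characters. -/
noncomputable def diagRep {G ι : Type*} [CommGroup G] (χ : ι → (G →* ℂˣ)) :
    Representation ℂ G (ι → ℂ) where
  toFun g := LinearMap.pi fun i => (χ i g : ℂ) • LinearMap.proj i
  map_one' := by ext; simp
  map_mul' g h := by ext; simp [mul_assoc]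

lemma exists_faithfulCovariantDims_le_rank (G : Type u) [CommGroup G] [Finite G] :
    ∃ d ∈ faithfulCovariantDims.{v, u} G, d ≤ (Group.rank G : WithBot ℕ∞) := by
  obtain ⟨χ, hχ⟩ := exists_separating_family (G := G)
  let ι := ULift.{v} (Fin (Group.rank G))
  let ρ : Representation ℂ G (ι → ℂ) := diagRep fun i : ι => χ i.down
  refine ⟨mapDim (id : (ι → ℂ) → (ι → ℂ)), ⟨ι → ℂ, ι → ℂ, inferInstance, inferInstance,
    inferInstance, inferInstance, inferInstance, inferInstance, ρ, ρ, id,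
    ⟨fun l => Algebra.subset_adjoin ⟨l, rfl⟩, fun _ _ => rfl⟩, fun g hg => ?_, rfl⟩, ?_⟩
  · refine hχ g fun i => ?_
    -- The all-ones vector has no zero coordinate, so fixing it forces every `χ i g = 1`.
    have h := congrFun (hg (fun _ => 1) ⟨_, rfl⟩) ⟨i⟩
    ext
    simpa [ρ, diagRep] using h
  · have b := (Pi.basisFun ℂ ι).dualBasis
    exact (varietyDim_le b b.span_eq _).trans (by simp [ι])

theorem corollary4p5 (G : Type u) [CommGroup G] [Finite G] (r : ℕ)
    (hr : Group.rank G = r) : covdim.{v, u} G = r := by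
  subst hr
  refine le_antisymm ?_ (le_sInf ?_)
  · obtain ⟨d, hd, hle⟩ := exists_faithfulCovariantDims_le_rank.{v, u} G
    exact (sInf_le hd).trans hle
  · rintro _ ⟨V, W, _, _, _, _, _, _, ρ, σ, φ, hφ, hfaith, rfl⟩
    exact hφ.rank_le_mapDim hfaith
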